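/- Let $f : X \to S$ be a morphism of schemes. Write $\mathrm{QRel}(f) \subseteq S$ for the set of points of the form $f(x)$, where $x \in X$ is such that the residue field extension $\kappa(f(x)) \subseteq \kappa(x)$ is purely inseparable (algebraic, possibly trivial). A scheme $S$ is called a *Poonen scheme* if for every nonempty open subscheme $U \subseteq S$ and every dominant morphism of finite presentation $f : X \to U$, one has $\mathrm{QRel}(f) \neq \emptyset$. Theorem. Let $S$ be a locally noetherian scheme all of whose irreducible components have (Krull) dimension $\geq 2$ (possibly infinite). Then $S$ is a Poonen scheme. -/

import Mathlib

open CategoryTheory AlgebraicGeometry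

universe u

/-- A homomorphism of fields `K → L` is radicial if `L` is a purely inseparable (algebraic)
extension of the image of `K`; in particular every isomorphism is radicial. -/
def IsRadicialFieldHom {K L : Type u} [Field K] [Field L] (φ : K →+* L) : Prop :=
  letI : Algebra K L := φ.toAlgebra
  IsPurelyInseparable K L

/-- The set of points `x` of `X` such that the residue field extension `κ(f x) → κ(x)`
is radicial. -/
def qRelSource {X S : Scheme.{u}} (f : X ⟶ S) : Set X :=
  {x | IsRadicialFieldHom (f.residueFieldMap x).hom}

/-- `QRel(f)`: the set of points of `S` that are quasi-liftable to `X`, i.e. the image under `f` of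
the set of points whose residue field extension is radicial. -/
def qRel {X S : Scheme.{u}} (f : X ⟶ S) : Set S :=
  (fun x : X => f x) '' qRelSource f

/-- A scheme `S` is a Poonen scheme if for every nonempty open `U ⊆ S` and every dominant
`U`-scheme `f : X ⟶ U` of finite presentation, the set `QRel(f)` is nonempty. -/
def IsPoonenScheme (S : Scheme.{u}) : Prop :=
  ∀ (U : S.Opens), (U : Set S).Nonempty →
    ∀ (X : Scheme.{u}) (f : X ⟶ (U : Scheme.{u})),
      LocallyOfFinitePresentation f → QuasiCompact f → QuasiSeparated f → IsDominant f →
        (qRel f).Nonempty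

/-!
# Locally noetherian schemes of dimension at least two are Poonen schemes

Let `η` be the generic point of an irreducible component of `S` meeting `U`. As `f` is dominant and
quasi-compact, `η = f x` for some `x` (`mem_range_of_isDominant`), and since the component has
dimension at least two there is a chain of proper specializations from `η` to `s₁` to `s₀`. These
need not lie in `U`, but they lie in an affine open of `S` containing `η`. So the question becomes
algebraic: `A` is a noetherian domain with a prime `m` of height at least two, and `R` is a finitely
generated `A`-algebra with nonzero generic fibre. A closed point of the generic fibre maps `R` to a
finite extension `L` of the fraction field `K` of `A`, and any prime of the image of `R` in `L` with
purely inseparable residue field extension solves the problem.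

The field `L` is purely inseparable over `K(h)` for some `h` integral over `A`. If a prime `Q` of
`A[h]` contains an element `x + y h` with `x, y ∈ A` and `y ∉ Q`, then `h` becomes the fraction
`-x / y` in the residue field of `Q`, which therefore equals that of `Q ∩ A`. Such a `Q`, avoiding
any given nonzero `c ∈ A`, exists by `exists_isPrime_add_mul_mem`: take a prime minimal over
`x ^ n + y h` and below a prime over `m`. It has height at most one by Krull's theorem, and for a
suitable `n` it is none of the finitely many primes minimal over `y c`; dimension two is what leaves
room to choose `x`. Let `q` be the characteristic exponent of `K`. Taking for `c` a
common denominator of the `q ^ N`-th powers, with `N` large, of the generators of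
`R`, these powers lie in the local ring of `A[h]` at `Q`. A valuation ring of `L` dominating that
local ring is integrally closed, hence contains the image of `R`, and its centre on `R` is the
required prime (`exists_isPrime_forall_mul_pow_sub_mem`).
-/

/-! ### Primes modulo which a given element becomes rational -/

/-- In a domain, only the zero prime lies strictly below a prime of height at most one. -/
theorem Ideal.eq_bot_of_lt_of_height_le_one {B : Type*} [CommRing B] [IsDomain B]
    {P Q : Ideal B} [hP : P.IsPrime] [Q.IsPrime] (hPQ : P < Q) (hQ : Q.height ≤ 1) : P = ⊥ := by
  have h1 : P.height < (1 : ℕ) := Ideal.height_le_iff.1 (by exact_mod_cast hQ) P hP hPQ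
  rw [Nat.cast_one, Order.lt_one_iff, Ideal.height_eq_zero_iff] at h1
  exact le_bot_iff.1 (h1.2 ⟨Ideal.isPrime_bot, le_rfl⟩ bot_le)

/-- Let `B` be an integral extension of `A`, where `A` has a prime `m` of height at least two, and
let `h ∈ B`. There are primes `Q` of `B`, avoiding any prescribed nonzero `c ∈ A`, whose residue
field contains the image of `h` as a fraction `-x / y` of elements of `A`.

With `M` a prime over `m`, the prime `Q` is chosen minimal over `b = x ^ n + y * h` inside `M`; by
Krull's principal ideal theorem it has height at most one, so it avoids `y * c` as soon as `b` lies
in none of the finitely many minimal primes of `y * c` below `M`. -/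
theorem exists_isPrime_add_mul_mem {A B : Type*} [CommRing A] [IsDomain A] [CommRing B]
    [IsDomain B] [IsNoetherianRing B] [Algebra A B] [Algebra.IsIntegral A B] [FaithfulSMul A B]
    {p m : Ideal A} [p.IsPrime] [m.IsPrime] (hp : p ≠ ⊥) (hpm : p < m) (h : B) {c : A}
    (hc : c ≠ 0) :
    ∃ Q : Ideal B, Q.IsPrime ∧ algebraMap A B c ∉ Q ∧ ∃ x y : A, algebraMap A B y ∉ Q ∧
      algebraMap A B x + algebraMap A B y * h ∈ Q := by
  have hinj : Function.Injective (algebraMap A B) := FaithfulSMul.algebraMap_injective A B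
  obtain ⟨P, -, hP, hPp⟩ := Ideal.exists_ideal_over_prime_of_isIntegral p (⊥ : Ideal B)
    (by rw [Ideal.comap_bot_of_injective _ hinj]; exact bot_le)
  obtain ⟨M, hPM, hM, hMm⟩ := Ideal.exists_ideal_over_prime_of_isIntegral m P
    (by rw [hPp]; exact hpm.le)
  have hPM : P < M := lt_of_le_of_ne hPM (by rintro rfl; exact hpm.ne (hPp.symm.trans hMm))
  have hP0 : ⊥ < P := bot_lt_iff_ne_bot.2
    (by rintro rfl; exact hp (by rw [← hPp, Ideal.comap_bot_of_injective _ hinj]))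
  obtain ⟨y, hyp, hy0⟩ := Submodule.exists_mem_ne_zero_of_ne_bot hp
  have hyM : algebraMap A B y ∈ M := by
    rw [← Ideal.mem_comap, hMm]; exact hpm.le hyp
  set d : B := algebraMap A B (y * c) with hd
  have hd0 : d ≠ 0 := by
    rw [hd, Ne, map_eq_zero_iff _ hinj]; exact mul_ne_zero hy0 hc
  -- primes of height at most one lie strictly below `M`
  have hlt : ∀ q : Ideal B, q.IsPrime → q ≤ M → q.height ≤ 1 → q < M := by
    intro q hq hqM hq1
    refine lt_of_le_of_ne hqM ?_
    rintro rfl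
    exact hP0.ne' (Ideal.eq_bot_of_lt_of_height_le_one hPM hq1)
  -- the finitely many minimal primes of `d` below `M`
  have hfin : {q ∈ (Ideal.span {d}).minimalPrimes | q ≤ M}.Finite :=
    (Ideal.finite_minimalPrimes_of_isNoetherianRing _ _).subset fun _ h ↦ h.1
  set F := hfin.toFinset with hF
  have hFmem : ∀ q, q ∈ F ↔ q ∈ (Ideal.span {d}).minimalPrimes ∧ q ≤ M := by
    intro q; simp [hF]
  have hht : ∀ q ∈ F, q.height ≤ 1 := fun q hq ↦
    Ideal.height_le_one_of_isPrincipal_of_mem_minimalPrimes _ _ ((hFmem q).1 hq).1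
  -- these primes contract to primes strictly below `m`, so prime avoidance applies
  obtain ⟨x, hxm, hx⟩ : ∃ x ∈ m, ∀ q ∈ F, algebraMap A B x ∉ q := by
    by_contra! hcon
    have : (m : Set A) ⊆ ⋃ q ∈ (F : Set (Ideal B)), (q.comap (algebraMap A B) : Ideal A) := by
      intro x hx
      obtain ⟨q, hq, hxq⟩ := hcon x hx
      exact Set.mem_biUnion (by exact_mod_cast hq) hxq
    rw [Ideal.subset_union_prime ⊥ ⊥
      (fun q hq _ _ ↦ have := ((hFmem q).1 hq).1.isPrime; inferInstance)] at this
    obtain ⟨q, hq, hmq⟩ := this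
    have hqp := ((hFmem q).1 hq).1.isPrime
    have h1 := hlt q hqp ((hFmem q).1 hq).2 (hht q hq)
    have h2 := Ideal.comap_lt_comap_of_integral_mem_sdiff h1.le
      (Set.exists_of_ssubset h1).choose_spec (Algebra.IsIntegral.isIntegral (R := A) _)
    rw [hMm] at h2
    exact h2.not_ge hmq
  have hxM : algebraMap A B x ∈ M := by rw [← Ideal.mem_comap, hMm]; exact hxm
  -- each of these primes contains `x ^ n + y * h` for at most one `n`: otherwise it contains some
  -- `1 - x ^ (k + 1)`, which is not in `M`
  obtain ⟨n, hn0, hn⟩ : ∃ n ≠ 0, ∀ q ∈ F, algebraMap A B x ^ n + algebraMap A B y * h ∉ q := by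
    have hsub : ∀ q ∈ F,
        {n : ℕ | algebraMap A B x ^ n + algebraMap A B y * h ∈ q}.Subsingleton := by
      intro q hq
      have hqp := ((hFmem q).1 hq).1.isPrime
      have key : ∀ i j : ℕ, i < j → algebraMap A B x ^ i + algebraMap A B y * h ∈ q →
          algebraMap A B x ^ j + algebraMap A B y * h ∈ q → False := by
        intro i j hij hi hj
        obtain ⟨k, rfl⟩ := Nat.exists_eq_add_of_lt hij
        have h1 := q.sub_mem hi hj
        have h2 : algebraMap A B x ^ i * (1 - algebraMap A B x ^ (k + 1)) ∈ q := by
          convert h1 using 1; ring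
        rcases hqp.mem_or_mem h2 with h3 | h3
        · exact hx q hq (hqp.mem_of_pow_mem _ h3)
        · apply hM.ne_top
          rw [Ideal.eq_top_iff_one]
          have h4 := M.add_mem (((hFmem q).1 hq).2 h3) (M.pow_mem_of_mem hxM (k + 1) k.succ_pos)
          simpa using h4
      intro i hi j hj
      rcases lt_trichotomy i j with h | h | h
      · exact (key i j h hi hj).elim
      · exact h
      · exact (key j i h hj hi).elim
    have hfin2 : (⋃ q ∈ (F : Set (Ideal B)),
        {n : ℕ | algebraMap A B x ^ n + algebraMap A B y * h ∈ q}).Finite :=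
      F.finite_toSet.biUnion fun q hq ↦ (hsub q (by exact_mod_cast hq)).finite
    obtain ⟨n, hn⟩ := (hfin2.insert 0).exists_notMem
    simp only [Set.mem_insert_iff, Set.mem_iUnion, not_or, not_exists] at hn
    exact ⟨n, hn.1, fun q hq ↦ hn.2 q (by exact_mod_cast hq)⟩
  set b := algebraMap A B x ^ n + algebraMap A B y * h with hb
  have hbM : b ∈ M := M.add_mem (M.pow_mem_of_mem hxM n (Nat.pos_of_ne_zero hn0))
    (M.mul_mem_right _ hyM)
  obtain ⟨Q, hQ, hQM⟩ := Ideal.exists_minimalPrimes_le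
    (show Ideal.span {b} ≤ M by rwa [Ideal.span_singleton_le_iff_mem])
  have hQp : Q.IsPrime := hQ.isPrime
  have hbQ : b ∈ Q := hQ.le (Ideal.mem_span_singleton_self b)
  have hQ1 := Ideal.height_le_one_of_isPrincipal_of_mem_minimalPrimes _ _ hQ
  have hdQ : d ∉ Q := by
    intro hdQ
    obtain ⟨q, hq, hqQ⟩ := Ideal.exists_minimalPrimes_le
      (show Ideal.span {d} ≤ Q by rwa [Ideal.span_singleton_le_iff_mem])
    have hqF : q ∈ F := (hFmem q).2 ⟨hq, hqQ.trans hQM⟩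
    have hqp := hq.isPrime
    -- `q` is nonzero and `Q` has height at most one, so they agree
    have hqQ' : q = Q := by
      by_contra hne
      have h1 := Ideal.eq_bot_of_lt_of_height_le_one (lt_of_le_of_ne hqQ hne) hQ1
      exact hd0 (by simpa [h1] using hq.le (Ideal.mem_span_singleton_self d))
    exact hn q hqF (hqQ' ▸ hbQ)
  rw [hd, map_mul] at hdQ
  exact ⟨Q, hQp, fun h ↦ hdQ (Q.mul_mem_left _ h), x ^ n, y, fun h ↦ hdQ (Q.mul_mem_right _ h),
    by rw [map_pow]; exact hbQ⟩

/-! ### Elements of finite extensions, up to denominators and inseparability -/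

/-- If `h = a • h₀`, then up to a denominator in `A` every element of `K[h₀]` lies in `A[h]`. -/
theorem exists_smul_mem_adjoin_of_mem_adjoin {A K E : Type*} [CommRing A] [IsDomain A] [Field K]
    [Field E] [Algebra A K] [IsFractionRing A K] [Algebra K E] [Algebra A E] [IsScalarTower A K E]
    {h₀ h : E} {a : A} (ha : a ≠ 0) (hh : h = a • h₀) {e : E} (he : e ∈ Algebra.adjoin K {h₀}) :
    ∃ c : A, c ≠ 0 ∧ c • e ∈ Algebra.adjoin A {h} := by
  induction he using Algebra.adjoin_induction with
  | mem x hx =>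
    rw [Set.mem_singleton_iff] at hx
    exact ⟨a, ha, by rw [hx, ← hh]; exact Algebra.self_mem_adjoin_singleton A h⟩
  | algebraMap r =>
    obtain ⟨n, d, hd, rfl⟩ := IsFractionRing.div_surjective (A := A) r
    have hd0 : algebraMap A K d ≠ 0 := by
      rw [Ne, IsFractionRing.to_map_eq_zero_iff]; exact nonZeroDivisors.ne_zero hd
    refine ⟨d, nonZeroDivisors.ne_zero hd, ?_⟩
    have : d • algebraMap K E (algebraMap A K n / algebraMap A K d) = algebraMap A E n := by
      rw [Algebra.smul_def, IsScalarTower.algebraMap_apply A K E, ← map_mul,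
        mul_div_cancel₀ _ hd0, ← IsScalarTower.algebraMap_apply]
    rw [this]
    exact Subalgebra.algebraMap_mem _ n
  | add x y _ _ hx hy =>
    obtain ⟨c, hc, hcx⟩ := hx
    obtain ⟨d, hd, hdy⟩ := hy
    refine ⟨c * d, mul_ne_zero hc hd, ?_⟩
    have : (c * d) • (x + y) = d • (c • x) + c • (d • y) := by
      simp only [Algebra.smul_def, map_mul]; ring
    rw [this]
    exact add_mem (Subalgebra.smul_mem _ hcx d) (Subalgebra.smul_mem _ hdy c)
  | mul x y _ _ hx hy =>
    obtain ⟨c, hc, hcx⟩ := hx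
    obtain ⟨d, hd, hdy⟩ := hy
    refine ⟨c * d, mul_ne_zero hc hd, ?_⟩
    have : (c * d) • (x * y) = (c • x) * (d • y) := by
      simp only [Algebra.smul_def, map_mul]; ring
    rw [this]
    exact mul_mem hcx hdy

/-- If `x + y h` lies in an ideal `Q`, then every element of `A[h]` becomes, after multiplication by
a power of `y`, congruent to an element of `A` modulo `Q`. -/
theorem exists_pow_mul_sub_mem_of_mem_adjoin {A L : Type*} [CommRing A] [CommRing L] [Algebra A L]
    {h : L} {Q : Ideal (Algebra.adjoin A {h})} {x y : A}
    (hxy : algebraMap A _ x + algebraMap A _ y * ⟨h, Algebra.self_mem_adjoin_singleton A h⟩ ∈ Q)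
    (b : Algebra.adjoin A {h}) :
    ∃ (k : ℕ) (a : A), algebraMap A _ (y ^ k) * b - algebraMap A _ a ∈ Q := by
  obtain ⟨b, hb⟩ := b
  induction hb using Algebra.adjoin_induction with
  | mem z hz =>
    rw [Set.mem_singleton_iff] at hz
    subst hz
    refine ⟨1, -x, ?_⟩
    rw [pow_one, map_neg, sub_neg_eq_add, add_comm]
    exact hxy
  | algebraMap r =>
    exact ⟨0, r, by convert Q.zero_mem; simp⟩
  | add z w hz hw h1 h2 =>
    obtain ⟨k, a, h1⟩ := h1
    obtain ⟨l, c, h2⟩ := h2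
    refine ⟨k + l, y ^ l * a + y ^ k * c, ?_⟩
    have := Q.add_mem (Q.mul_mem_left (algebraMap A _ (y ^ l)) h1)
      (Q.mul_mem_left (algebraMap A _ (y ^ k)) h2)
    convert this using 1
    have : (⟨z + w, add_mem hz hw⟩ : Algebra.adjoin A {h}) = ⟨z, hz⟩ + ⟨w, hw⟩ := rfl
    rw [this]
    simp only [map_mul, map_add, map_pow]; ring
  | mul z w hz hw h1 h2 =>
    obtain ⟨k, a, h1⟩ := h1
    obtain ⟨l, c, h2⟩ := h2
    refine ⟨k + l, a * c, ?_⟩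
    have := Q.add_mem (Q.mul_mem_left (algebraMap A _ (y ^ l) * ⟨w, hw⟩) h1)
      (Q.mul_mem_left (algebraMap A _ a) h2)
    convert this using 1
    have : (⟨z * w, mul_mem hz hw⟩ : Algebra.adjoin A {h}) = ⟨z, hz⟩ * ⟨w, hw⟩ := rfl
    rw [this]
    simp only [map_mul, map_pow]; ring

/-- A finite extension of the fraction field of `A` is purely inseparable over a subextension
generated by a single element `h` integral over `A`; up to denominators in `A`, a uniform power of
any element lies in `A[h]`. -/
theorem exists_isIntegral_forall_smul_pow_mem_adjoin (A K L : Type*) [CommRing A] [IsDomain A]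
    [Field K] [Field L] [Algebra A K] [IsFractionRing A K] [Algebra K L] [Algebra A L]
    [IsScalarTower A K L] [Module.Finite K L] (q : ℕ) [ExpChar K q] :
    ∃ (h : L) (N : ℕ), IsIntegral A h ∧
      ∀ z : L, ∃ c : A, c ≠ 0 ∧ c • z ^ q ^ N ∈ Algebra.adjoin A {h} := by
  -- a multiple of a primitive element of the separable closure of `K` in `L`, over which `L` is
  -- purely inseparable of bounded exponent
  let E := separableClosure K L
  have : IsScalarTower A E L := .of_algebraMap_eq fun _ ↦ rfl
  obtain ⟨h₀, hh₀⟩ := Field.exists_primitive_element K E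
  obtain ⟨⟨a, ha⟩, hint⟩ := IsIntegral.exists_multiple_integral_of_isLocalization
    (nonZeroDivisors A) h₀ (Algebra.IsIntegral.isIntegral (R := K) h₀)
  have hexp : ExpChar E q := expChar_of_injective_algebraMap (algebraMap K E).injective q
  refine ⟨algebraMap E L (a • h₀), IsPurelyInseparable.exponent E L, hint.algebraMap, fun z ↦ ?_⟩
  obtain ⟨e, he⟩ := IsPurelyInseparable.exponent_def' E q z
  have hmem : e ∈ Algebra.adjoin K {h₀} := by
    rw [← IntermediateField.adjoin_simple_toSubalgebra_of_isAlgebraic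
      (Algebra.IsAlgebraic.isAlgebraic h₀), hh₀]
    exact Algebra.mem_top
  obtain ⟨c, hc, hce⟩ := exists_smul_mem_adjoin_of_mem_adjoin (nonZeroDivisors.ne_zero ha) rfl hmem
  refine ⟨c, hc, ?_⟩
  rw [← he]
  have := Subalgebra.mem_map (f := IsScalarTower.toAlgHom A E L) |>.2 ⟨_, hce, rfl⟩
  rw [AlgHom.map_adjoin, Set.image_singleton] at this
  simpa using this

/-! ### Primes with purely inseparable residue field extension -/

/-- Let `R` be a finitely generated `A`-subalgebra of a finite extension of the fraction field
of `A`. If `A` has a prime of height at least two, some prime `𝔮` of `R` has residue field purely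
inseparable over the residue field of its contraction to `A`: modulo `𝔮`, the `q ^ N`-th power of
any element of `R` is a fraction of elements of `A`, where `q` is the characteristic exponent of
the fraction field. It need not be that of the residue field, but only when `q = 1`.

The prime `𝔮` is the centre of a valuation ring dominating a suitable local ring of `A[h]`, where
the field is purely inseparable over the subfield generated by `h`. -/
theorem exists_isPrime_forall_mul_pow_sub_mem {A K L : Type*} [CommRing A] [IsDomain A]
    [IsNoetherianRing A] [Field K] [Field L] [Algebra A K] [IsFractionRing A K] [Algebra K L]
    [Algebra A L] [IsScalarTower A K L] [Module.Finite K L] {p m : Ideal A} [p.IsPrime]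
    [m.IsPrime] (hp : p ≠ ⊥) (hpm : p < m) {R : Subalgebra A L} (hR : R.FG) :
    ∃ 𝔮 : Ideal R, 𝔮.IsPrime ∧ ∃ q N : ℕ, (q = 1 ∨ q.Prime ∧ (q : R) ∈ 𝔮) ∧
      ∀ r : R, ∃ s a : A, algebraMap A R s ∉ 𝔮 ∧
        algebraMap A R s * r ^ q ^ N - algebraMap A R a ∈ 𝔮 := by
  classical
  obtain ⟨q, hq⟩ := ExpChar.exists K
  have hqL : ExpChar L q := expChar_of_injective_algebraMap (algebraMap K L).injective q
  have hAL : Function.Injective (algebraMap A L) := by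
    rw [IsScalarTower.algebraMap_eq A K L]
    exact (algebraMap K L).injective.comp (IsFractionRing.injective A K)
  have : FaithfulSMul A L := (faithfulSMul_iff_algebraMap_injective A L).2 hAL
  obtain ⟨h, N, hh, hpow⟩ := exists_isIntegral_forall_smul_pow_mem_adjoin A K L q
  obtain ⟨t, ht⟩ := hR
  choose c hc0 hc using hpow
  let B := Algebra.adjoin A {h}
  have : Algebra.IsIntegral A B := Algebra.IsIntegral.adjoin (by simpa)
  have : Algebra.FiniteType A B := (Subalgebra.fg_iff_finiteType _).1 ⟨{h}, by simp [B]⟩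
  have : IsNoetherianRing B := Algebra.FiniteType.isNoetherianRing A B
  have : FaithfulSMul A B := (faithfulSMul_iff_algebraMap_injective A B).2 fun x y hxy ↦
    hAL congr(($hxy : L))
  obtain ⟨Q, hQ, hcQ, x, y, hyQ, hxy⟩ := exists_isPrime_add_mul_mem hp hpm
    (⟨h, Algebra.self_mem_adjoin_singleton A h⟩ : B) (c := ∏ z ∈ t, c z)
    (Finset.prod_ne_zero_iff.2 fun z _ ↦ hc0 z)
  -- the denominators of the `q ^ N`-th powers of the generators of `R` are not in `Q`
  have hcQ' : ∀ z ∈ t, algebraMap A B (c z) ∉ Q := fun z hz h ↦ hcQ <| by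
    rw [← Finset.mul_prod_erase t _ hz, map_mul]; exact Q.mul_mem_right _ h
  -- a valuation ring of `L` dominating the local ring of `B` at `Q`
  let B' : Subring L := B.toSubring
  let Q' : Ideal B' := Q
  have hQ' : Q'.IsPrime := hQ
  let P := LocalSubring.ofPrime B' Q'
  obtain ⟨O, hPO, hloc⟩ := P.exists_le_valuationSubring
  have hBO : ∀ b : B, (b : L) ∈ O := fun b ↦ hPO (LocalSubring.le_ofPrime B' Q' b.2)
  have hunit : ∀ b : B, b ∉ Q → (b : L)⁻¹ ∈ P.toSubring := by
    intro b hb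
    have h1 := (IsLocalization.AtPrime.isUnit_to_map_iff P.toSubring Q' b).2 hb
    obtain ⟨u, hu⟩ := isUnit_iff_exists_inv.1 h1
    have h2 : (b : L) * u = 1 := congr(($hu : L))
    rw [inv_eq_of_mul_eq_one_right h2]
    exact u.2
  have hmax : ∀ b : B, (⟨b, hBO b⟩ : O) ∈ IsLocalRing.maximalIdeal O ↔ b ∈ Q := by
    intro b
    refine ⟨fun hb ↦ ?_, fun hb hu ↦ ?_⟩
    · by_contra hbQ
      refine hb (isUnit_iff_exists_inv.2 ⟨⟨(b : L)⁻¹, hPO (hunit b hbQ)⟩, Subtype.ext ?_⟩)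
      refine mul_inv_cancel₀ fun h0 ↦ hbQ ?_
      rw [show b = 0 from Subtype.ext h0]
      exact Q.zero_mem
    · have h1 : IsUnit (algebraMap B' P.toSubring b) :=
        hloc.map_nonunit (algebraMap B' P.toSubring b) hu
      exact (IsLocalization.AtPrime.isUnit_to_map_iff P.toSubring Q' b).1 h1 hb
  -- the elements whose `q ^ N`-th power lies in the local ring form a subring containing `R`
  have hRP : ∀ r ∈ R, r ^ q ^ N ∈ P.toSubring := by
    intro r hr
    rw [← ht] at hr
    let T : Subalgebra A L :=
      { (P.toSubring.comap (iterateFrobenius L q N)).toSubsemiring with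
        algebraMap_mem' := fun a ↦ by
          change algebraMap A L a ^ q ^ N ∈ P.toSubring
          exact pow_mem (LocalSubring.le_ofPrime B' Q' (Subalgebra.algebraMap_mem B a)) _ }
    have hT : Algebra.adjoin A (t : Set L) ≤ T := by
      rw [Algebra.adjoin_le_iff]
      intro z hz
      change z ^ q ^ N ∈ P.toSubring
      have h1 : algebraMap A L (c z) ≠ 0 := by
        rw [Ne, map_eq_zero_iff _ hAL]; exact hc0 z
      have h2 : z ^ q ^ N = (algebraMap A L (c z))⁻¹ * (c z • z ^ q ^ N) := by
        rw [Algebra.smul_def, inv_mul_cancel_left₀ h1]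
      rw [h2]
      exact mul_mem (hunit _ (hcQ' z hz)) (LocalSubring.le_ofPrime B' Q' (hc z))
    exact hT hr
  -- valuation rings are integrally closed, so `R` is contained in `O`
  have hqN : q ^ N ≠ 0 := pow_ne_zero _ (expChar_pos K q).ne'
  have hRO : ∀ r ∈ R, r ∈ O := by
    intro r hr
    have h1 : r ^ q ^ N ∈ O := hPO (hRP r hr)
    rcases O.mem_or_inv_mem r with h | h
    · exact h
    · obtain ⟨n, hn⟩ := Nat.exists_eq_succ_of_ne_zero hqN
      rcases eq_or_ne r 0 with rfl | h0
      · exact O.zero_mem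
      have h2 : r = r ^ q ^ N * r⁻¹ ^ n := by
        rw [hn, pow_succ, inv_pow]; field_simp
      rw [h2]
      exact mul_mem h1 (pow_mem h n)
  let ι : R →+* O := R.val.toRingHom.codRestrict O.toSubring fun r ↦ hRO r r.2
  refine ⟨(IsLocalRing.maximalIdeal O).comap ι, inferInstance, q, N, ?_, fun r ↦ ?_⟩
  · rcases hq with _ | ⟨hqp⟩
    · exact .inl rfl
    · refine .inr ⟨hqp, ?_⟩
      have h0 : ((q : ℕ) : R) = 0 := Subtype.ext (by
        have := congr(algebraMap K L $(CharP.cast_eq_zero K q))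
        rw [map_natCast, map_zero] at this
        exact (map_natCast R.val q).trans this)
      rw [h0]
      exact Ideal.zero_mem _
  -- writing `r ^ q ^ N = b / s` with `b, s ∈ B`, both `b` and `s` are fractions of elements of `A`
  -- modulo `Q`
  · obtain ⟨⟨b, s⟩, hbs⟩ := IsLocalization.surj Q'.primeCompl
      (⟨_, hRP r r.2⟩ : P.toSubring)
    replace hbs : (r : L) ^ q ^ N * (s : B') = b := congr(($hbs : L))
    obtain ⟨j, a', hs⟩ := exists_pow_mul_sub_mem_of_mem_adjoin hxy (s : B')
    obtain ⟨k, a, hb⟩ := exists_pow_mul_sub_mem_of_mem_adjoin hxy b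
    have ha' : algebraMap A B a' ∉ Q := fun ha' ↦ by
      have h1 := Q.add_mem hs ha'
      rw [sub_add_cancel] at h1
      rcases hQ.mem_or_mem h1 with h2 | h2
      · rw [map_pow] at h2
        exact hyQ (hQ.mem_of_pow_mem _ h2)
      · exact s.2 h2
    have key : ∀ a : A, ι (algebraMap A R a) = ⟨(algebraMap A B a : L), hBO _⟩ := fun _ ↦ rfl
    refine ⟨a' * y ^ k, a * y ^ j, ?_, ?_⟩
    · rw [Ideal.mem_comap, key, hmax, map_mul, map_pow]
      intro h
      rcases hQ.mem_or_mem h with h | h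
      · exact ha' h
      · exact hyQ (hQ.mem_of_pow_mem _ h)
    · rw [Ideal.mem_comap]
      have h1 := (hmax _).2 hs
      have h2 := (hmax _).2 hb
      have h3 := sub_mem (Ideal.mul_mem_left _ (ι (algebraMap A R (y ^ j))) h2)
        (Ideal.mul_mem_left _ (ι (algebraMap A R (y ^ k) * r ^ q ^ N)) h1)
      convert h3 using 1
      apply Subtype.ext
      change algebraMap A L (a' * y ^ k) * (r : L) ^ q ^ N - algebraMap A L (a * y ^ j) =
        algebraMap A L (y ^ j) * (algebraMap A L (y ^ k) * (b : L) - algebraMap A L a) -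
        algebraMap A L (y ^ k) * (r : L) ^ q ^ N *
          (algebraMap A L (y ^ j) * ((s : B') : L) - algebraMap A L a')
      rw [← hbs]
      simp only [map_mul, map_pow]
      ring

/-- A nonempty fibre of an algebra of finite type has a point whose residue field is finite over
that of the base. -/
theorem exists_finite_extension_of_liesOver {A R : Type u} [CommRing A] [CommRing R] [Algebra A R]
    [Algebra.FiniteType A R] (I : Ideal A) [I.IsPrime] (𝔵 : Ideal R) [𝔵.IsPrime] [𝔵.LiesOver I] :
    ∃ (L : Type u) (_ : Field L) (_ : Algebra I.ResidueField L) (ψ : R →+* L),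
      Module.Finite I.ResidueField L ∧ ∀ a, ψ (algebraMap A R a) =
        algebraMap I.ResidueField L (algebraMap A I.ResidueField a) := by
  let K := I.ResidueField
  let T := TensorProduct A K R
  have : Nontrivial T := (Algebra.TensorProduct.productMap
    (Ideal.ResidueField.mapₐ I 𝔵 (Algebra.ofId A R) (Ideal.over_def 𝔵 I))
    (IsScalarTower.toAlgHom A R 𝔵.ResidueField)).toRingHom.domain_nontrivial
  obtain ⟨M, hM⟩ := Ideal.exists_maximal T
  let : Field (T ⧸ M) := Ideal.Quotient.field M
  refine ⟨T ⧸ M, inferInstance, inferInstance, (Ideal.Quotient.mk M).comp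
    (Algebra.TensorProduct.includeRight (R := A) (A := K) (B := R)).toRingHom, ?_, fun a ↦ ?_⟩
  · exact finite_of_finite_type_of_isJacobsonRing K (T ⧸ M)
  · change Ideal.Quotient.mk M _ = Ideal.Quotient.mk M (algebraMap K T _)
    congr 1
    simp [T, K]

/-- The statement of `exists_isPrime_forall_mul_pow_sub_mem` for an arbitrary algebra of finite
type; a prime `𝔵` of `R` whose contraction starts a chain of primes of `A` of length two takes the
place of the zero ideal. -/
theorem exists_isPrime_forall_mul_pow_sub_mem_of_finiteType {A R : Type u} [CommRing A]
    [IsNoetherianRing A] [CommRing R] [Algebra A R] [Algebra.FiniteType A R] {𝔵 : Ideal R}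
    [𝔵.IsPrime] {p m : Ideal A} [p.IsPrime] [m.IsPrime] (hp : 𝔵.under A < p) (hpm : p < m) :
    ∃ 𝔮 : Ideal R, 𝔮.IsPrime ∧ ∃ q N : ℕ, (q = 1 ∨ q.Prime ∧ (q : R) ∈ 𝔮) ∧
      ∀ r : R, ∃ s a : A, algebraMap A R s ∉ 𝔮 ∧
        algebraMap A R s * r ^ q ^ N - algebraMap A R a ∈ 𝔮 := by
  classical
  let I := 𝔵.under A
  obtain ⟨L, _, _, ψ, _, hψ⟩ := exists_finite_extension_of_liesOver I 𝔵
  let : Algebra (A ⧸ I) L :=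
    ((algebraMap I.ResidueField L).comp (algebraMap (A ⧸ I) I.ResidueField)).toAlgebra
  have : IsScalarTower (A ⧸ I) I.ResidueField L := .of_algebraMap_eq fun _ ↦ rfl
  have hψ' : ∀ a, ψ (algebraMap A R a) = algebraMap (A ⧸ I) L (Ideal.Quotient.mk I a) := hψ
  obtain ⟨t, ht⟩ := (‹Algebra.FiniteType A R›).out
  let R' : Subalgebra (A ⧸ I) L := Algebra.adjoin (A ⧸ I) (t.image ψ : Set L)
  have hR' : ∀ r, ψ r ∈ R' := by
    intro r
    have hr : r ∈ Algebra.adjoin A (t : Set R) := ht ▸ Algebra.mem_top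
    induction hr using Algebra.adjoin_induction with
    | mem x hx => exact Algebra.subset_adjoin (Finset.mem_coe.2 (Finset.mem_image_of_mem ψ hx))
    | algebraMap a => rw [hψ']; exact Subalgebra.algebraMap_mem _ _
    | add x y _ _ hx hy => rw [map_add]; exact add_mem hx hy
    | mul x y _ _ hx hy => rw [map_mul]; exact mul_mem hx hy
  let ψ' : R →+* R' := ψ.codRestrict R' hR'
  have hψ'' : ∀ a, ψ' (algebraMap A R a) = algebraMap (A ⧸ I) R' (Ideal.Quotient.mk I a) :=
    fun a ↦ Subtype.ext (hψ' a)
  have hprime : ∀ J : Ideal A, J.IsPrime → I ≤ J → (J.map (Ideal.Quotient.mk I)).IsPrime :=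
    fun J hJ hIJ ↦ Ideal.map_isPrime_of_surjective Ideal.Quotient.mk_surjective
      (by rwa [Ideal.mk_ker])
  have hcomap : ∀ J : Ideal A, I ≤ J → (J.map (Ideal.Quotient.mk I)).comap
      (Ideal.Quotient.mk I) = J := fun J hIJ ↦ by
    rw [Ideal.comap_map_of_surjective _ Ideal.Quotient.mk_surjective, ← RingHom.ker_eq_comap_bot,
      Ideal.mk_ker, sup_eq_left.2 hIJ]
  have := hprime p ‹_› hp.le
  have := hprime m ‹_› (hp.trans hpm).le
  obtain ⟨𝔮, h𝔮, q, N, hq, hr⟩ := exists_isPrime_forall_mul_pow_sub_mem (K := I.ResidueField)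
    (p := p.map (Ideal.Quotient.mk I)) (m := m.map (Ideal.Quotient.mk I)) (R := R')
    (fun h ↦ hp.ne (by rw [← hcomap p hp.le, h, ← RingHom.ker_eq_comap_bot, Ideal.mk_ker]))
    (lt_of_le_of_ne (Ideal.map_mono hpm.le) fun h ↦ hpm.ne
      (by rw [← hcomap p hp.le, h, hcomap m (hp.trans hpm).le])) ⟨_, rfl⟩
  refine ⟨𝔮.comap ψ', inferInstance, q, N, ?_, fun r ↦ ?_⟩
  · simpa using hq
  · obtain ⟨s, a, hs, ha⟩ := hr (ψ' r)
    obtain ⟨s, rfl⟩ := Ideal.Quotient.mk_surjective s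
    obtain ⟨a, rfl⟩ := Ideal.Quotient.mk_surjective a
    refine ⟨s, a, ?_, ?_⟩
    · rwa [Ideal.mem_comap, hψ'']
    · rwa [Ideal.mem_comap, map_sub, map_mul, map_pow, hψ'', hψ'']

/-! ### Points of affine opens, prime ideals and residue fields -/

namespace AlgebraicGeometry

theorem IsAffineOpen.mem_primeIdealOf_iff {X : Scheme.{u}} {U : X.Opens} (hU : IsAffineOpen U)
    {x : X} (hx : x ∈ U) (a : Γ(X, U)) :
    a ∈ (hU.primeIdealOf ⟨x, hx⟩).asIdeal ↔ X.evaluation U x hx a = 0 := by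
  rw [hU.primeIdealOf_eq_map_closedPoint]
  exact (IsLocalRing.residue_eq_zero_iff _).symm

theorem IsAffineOpen.primeIdealOf_le_of_specializes {X : Scheme.{u}} {U : X.Opens}
    (hU : IsAffineOpen U) {x y : X} (hx : x ∈ U) (hy : y ∈ U) (h : x ⤳ y) :
    (hU.primeIdealOf ⟨x, hx⟩).asIdeal ≤ (hU.primeIdealOf ⟨y, hy⟩).asIdeal := by
  intro a ha
  rw [hU.mem_primeIdealOf_iff] at ha ⊢
  by_contra hne
  rw [← ne_eq, X.evaluation_ne_zero_iff_mem_basicOpen] at hne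
  exact (X.evaluation_ne_zero_iff_mem_basicOpen x hx a).2
    (h.mem_open (X.basicOpen a).isOpen hne) ha

theorem IsAffineOpen.primeIdealOf_lt_of_specializes {X : Scheme.{u}} {U : X.Opens}
    (hU : IsAffineOpen U) {x y : X} (hx : x ∈ U) (hy : y ∈ U) (h : x ⤳ y) (hne : x ≠ y) :
    (hU.primeIdealOf ⟨x, hx⟩).asIdeal < (hU.primeIdealOf ⟨y, hy⟩).asIdeal := by
  refine lt_of_le_of_ne (hU.primeIdealOf_le_of_specializes hx hy h) fun heq ↦ hne ?_
  have := congr(hU.fromSpec $(PrimeSpectrum.ext heq))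
  rwa [hU.fromSpec_primeIdealOf, hU.fromSpec_primeIdealOf] at this

theorem IsAffineOpen.exists_primeIdealOf_eq {X : Scheme.{u}} {U : X.Opens} (hU : IsAffineOpen U)
    (p : Ideal Γ(X, U)) (hp : p.IsPrime) :
    ∃ (x : X) (hx : x ∈ U), (hU.primeIdealOf ⟨x, hx⟩).asIdeal = p := by
  let P : Spec Γ(X, U) := ⟨p, hp⟩
  have hx : hU.fromSpec P ∈ U := by
    have : hU.fromSpec P ∈ Set.range hU.fromSpec := ⟨P, rfl⟩
    rwa [hU.range_fromSpec] at this
  refine ⟨hU.fromSpec P, hx, ?_⟩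
  have : hU.primeIdealOf ⟨_, hx⟩ = P :=
    hU.fromSpec.isOpenEmbedding.injective (hU.fromSpec_primeIdealOf _)
  rw [this]

theorem IsAffineOpen.specializes_of_primeIdealOf_le {X : Scheme.{u}} {U : X.Opens}
    (hU : IsAffineOpen U) {x y : X} (hx : x ∈ U) (hy : y ∈ U)
    (h : (hU.primeIdealOf ⟨x, hx⟩).asIdeal ≤ (hU.primeIdealOf ⟨y, hy⟩).asIdeal) : x ⤳ y := by
  have h1 : hU.primeIdealOf ⟨x, hx⟩ ⤳ hU.primeIdealOf ⟨y, hy⟩ :=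
    (PrimeSpectrum.le_iff_specializes _ _).1 h
  have h2 := h1.map hU.fromSpec.continuous
  rwa [hU.fromSpec_primeIdealOf, hU.fromSpec_primeIdealOf] at h2

theorem evaluation_appLE {X Y : Scheme.{u}} (f : X ⟶ Y) {V : Y.Opens} {W : X.Opens}
    (h : W ≤ f ⁻¹ᵁ V) {x : X} (hx : x ∈ W) (hfx : f x ∈ V) (a : Γ(Y, V)) :
    X.evaluation W x hx (f.appLE V W h a) =
      f.residueFieldMap x (Y.evaluation V (f x) hfx a) := by
  rw [Scheme.evaluation_naturality_apply]
  have h1 := congr($(X.presheaf.germ_res (homOfLE h) x hx) (f.app V a))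
  exact congr(X.residue x $h1)

/-- A quasi-compact dominant morphism hits every point without proper generizations. -/
theorem mem_range_of_isDominant {X Y : Scheme.{u}} (f : X ⟶ Y) [QuasiCompact f] [IsDominant f]
    {η : Y} (hη : ∀ y, y ⤳ η → y = η) : η ∈ Set.range f := by
  obtain ⟨V, hV, hηV, -⟩ := exists_isAffineOpen_mem_and_subset (x := η) (U := ⊤) trivial
  have hc : IsCompact (f ⁻¹ᵁ V : Set X) := f.isCompact_preimage hV.isCompact
  have hmem : η ∈ closure (f '' (f ⁻¹ᵁ V : Set X)) := by
    rw [mem_closure_iff]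
    intro O hO hηO
    obtain ⟨_, ⟨hyO, hyV⟩, x, rfl⟩ := mem_closure_iff.1 (f.denseRange η) (O ∩ V)
      (hO.inter V.isOpen) ⟨hηO, hηV⟩
    exact ⟨f x, hyO, x, hyV, rfl⟩
  -- by quasi-compactness, `η` is in the closure of the image of an affine open
  refine IsCompact.induction_on (p := fun t ↦ η ∈ closure (f '' t) → η ∈ Set.range f) hc
    (by simp) (fun s t hst ht h ↦ ht (closure_mono (Set.image_mono hst) h))
    (fun s t hs ht h ↦ ?_) (fun x hx ↦ ?_) hmem
  · rw [Set.image_union, closure_union] at h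
    exact h.elim hs ht
  obtain ⟨W, hW, hxW, hWV⟩ := exists_isAffineOpen_mem_and_subset (x := x) (U := f ⁻¹ᵁ V) hx
  replace hWV : W ≤ f ⁻¹ᵁ V := hWV
  refine ⟨W, mem_nhdsWithin_of_mem_nhds (W.isOpen.mem_nhds hxW), fun hη' ↦ ?_⟩
  let φ := (f.appLE V W hWV).hom
  have hker : (⊥ : Ideal Γ(X, W)).comap φ ≤ (hV.primeIdealOf ⟨η, hηV⟩).asIdeal := by
    intro a ha
    rw [hV.mem_primeIdealOf_iff]
    by_contra hne
    rw [← ne_eq, Y.evaluation_ne_zero_iff_mem_basicOpen] at hne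
    obtain ⟨_, hy, w, hw, rfl⟩ := mem_closure_iff.1 hη' _ (Y.basicOpen a).isOpen hne
    refine (Y.evaluation_ne_zero_iff_mem_basicOpen (f w) (hWV hw) a).2 hy ?_
    refine (f.residueFieldMap w).hom.injective ?_
    have h1 := evaluation_appLE f hWV hw (hWV hw) a
    rw [show f.appLE V W hWV a = 0 from ha] at h1
    simpa using h1.symm
  have hmin : (hV.primeIdealOf ⟨η, hηV⟩).asIdeal ∈
      ((⊥ : Ideal Γ(X, W)).comap φ).minimalPrimes := by
    refine ⟨⟨inferInstance, hker⟩, fun p ⟨hp, _⟩ hle ↦ ?_⟩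
    obtain ⟨y, hy, rfl⟩ := hV.exists_primeIdealOf_eq p hp
    obtain rfl := hη y (hV.specializes_of_primeIdealOf_le hy hηV hle)
    exact le_rfl
  obtain ⟨p, hp, -, hpη⟩ := Ideal.exists_comap_eq_of_mem_minimalPrimes φ _ hmin
  obtain ⟨w, hw, rfl⟩ := hW.exists_primeIdealOf_eq p hp
  refine ⟨w, hη _ (hV.specializes_of_primeIdealOf_le (hWV hw) hηV ?_)⟩
  rw [← hpη, ← hV.comap_primeIdealOf_appLE V W hW hWV hw]
  exact le_rfl

theorem IsAffineOpen.exists_eq_evaluation_div {X : Scheme.{u}} {U : X.Opens} (hU : IsAffineOpen U)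
    {x : X} (hx : x ∈ U) (z : X.residueField x) : ∃ r s : Γ(X, U),
      X.evaluation U x hx s ≠ 0 ∧ z = X.evaluation U x hx r / X.evaluation U x hx s := by
  obtain ⟨t, rfl⟩ := X.residue_surjective x z
  let := X.presheaf.algebra_section_stalk ⟨x, hx⟩
  have := hU.isLocalization_stalk ⟨x, hx⟩
  obtain ⟨⟨r, s⟩, hrs⟩ := IsLocalization.surj (hU.primeIdealOf ⟨x, hx⟩).asIdeal.primeCompl t
  have hs : X.evaluation U x hx s ≠ 0 := fun h ↦ s.2 ((hU.mem_primeIdealOf_iff hx _).2 h)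
  refine ⟨r, s, hs, (eq_div_iff hs).2 ?_⟩
  exact (map_mul (X.residue x).hom t _).symm.trans congr(X.residue x $hrs)

end AlgebraicGeometry

/-! ### Radicial residue field extensions -/

/-- For `q = 1`, which need not be the characteristic exponent of `K`, the hypothesis says that `φ` is
surjective. -/
theorem isRadicialFieldHom_of_forall_pow_mem {K L : Type u} [Field K] [Field L] (φ : K →+* L)
    {q N : ℕ} (hq : q = 1 ∨ q.Prime ∧ (q : L) = 0) (h : ∀ z : L, z ^ q ^ N ∈ φ.fieldRange) :
    IsRadicialFieldHom φ := by
  let : Algebra K L := φ.toAlgebra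
  rcases hq with rfl | ⟨hq, hq0⟩
  · obtain ⟨p, hp⟩ := ExpChar.exists K
    exact (isPurelyInseparable_iff_pow_mem K p).2 fun z ↦ ⟨0, by
      have hz := h z
      rw [one_pow, pow_one] at hz
      rw [pow_zero, pow_one]
      exact hz⟩
  · have hqK : (q : K) = 0 := φ.injective (by rw [map_natCast, hq0, map_zero])
    have : Fact q.Prime := ⟨hq⟩
    have : CharP K q := by
      obtain ⟨p, hp⟩ := CharP.exists K
      have h1 := (CharP.cast_eq_zero_iff K p q).1 hqK
      rcases (Nat.dvd_prime hq).1 h1 with rfl | rfl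
      · exact (CharP.char_ne_one K 1 rfl).elim
      · exact hp
    have : ExpChar K q := .prime hq
    exact (isPurelyInseparable_iff_pow_mem K q).2 fun z ↦ ⟨N, h z⟩

theorem IsRadicialFieldHom.of_comp {K L M : Type u} [Field K] [Field L] [Field M] {φ : K →+* L}
    {ψ : L →+* M} (h : IsRadicialFieldHom (ψ.comp φ)) : IsRadicialFieldHom ψ := by
  let : Algebra K L := φ.toAlgebra
  let : Algebra L M := ψ.toAlgebra
  let : Algebra K M := (ψ.comp φ).toAlgebra
  have : IsScalarTower K L M := .of_algebraMap_eq fun _ ↦ rfl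
  have : IsPurelyInseparable K M := h
  exact IsPurelyInseparable.tower_top K L M

/-- If the image of `f` contains a point with a chain of two proper specializations, then some point
of the source has a radicial residue field extension. Neither specialization has to lie in the image
of `f`. -/
theorem nonempty_qRelSource_of_specializes {X S : Scheme.{u}} [IsLocallyNoetherian S] (f : X ⟶ S)
    [LocallyOfFiniteType f] {x : X} {s₁ s₀ : S} (h₁ : f x ⤳ s₁) (h₁' : f x ≠ s₁) (h₀ : s₁ ⤳ s₀)
    (h₀' : s₁ ≠ s₀) : (qRelSource f).Nonempty := by
  obtain ⟨V, hV, h0V, -⟩ := exists_isAffineOpen_mem_and_subset (x := s₀) (U := ⊤) trivial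
  have h1V : s₁ ∈ V := h₀.mem_open V.isOpen h0V
  have hxV : f x ∈ V := h₁.mem_open V.isOpen h1V
  obtain ⟨W, hW, hxW, hWV⟩ := exists_isAffineOpen_mem_and_subset (x := x) (U := f ⁻¹ᵁ V) hxV
  replace hWV : W ≤ f ⁻¹ᵁ V := hWV
  let := (f.appLE V W hWV).hom.toAlgebra
  have : Algebra.FiniteType Γ(S, V) Γ(X, W) := f.finiteType_appLE hV hW hWV
  have : IsNoetherianRing Γ(S, V) := IsLocallyNoetherian.component_noetherian ⟨V, hV⟩
  obtain ⟨𝔮, h𝔮, q, N, hq, hr⟩ := exists_isPrime_forall_mul_pow_sub_mem_of_finiteType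
    (A := Γ(S, V)) (R := Γ(X, W)) (𝔵 := (hW.primeIdealOf ⟨x, hxW⟩).asIdeal)
    (p := (hV.primeIdealOf ⟨s₁, h1V⟩).asIdeal) (m := (hV.primeIdealOf ⟨s₀, h0V⟩).asIdeal)
    (by
      have := congr(($(hV.comap_primeIdealOf_appLE V W hW hWV hxW)).asIdeal)
      exact this.trans_lt (hV.primeIdealOf_lt_of_specializes hxV h1V h₁ h₁'))
    (hV.primeIdealOf_lt_of_specializes h1V h0V h₀ h₀')
  obtain ⟨w, hw, rfl⟩ := hW.exists_primeIdealOf_eq 𝔮 h𝔮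
  refine ⟨w, isRadicialFieldHom_of_forall_pow_mem (q := q) (N := N) _ ?_ ?_⟩
  · refine hq.imp_right fun h ↦ ⟨h.1, ?_⟩
    have := (hW.mem_primeIdealOf_iff hw _).1 h.2
    rwa [map_natCast] at this
  · have key : ∀ r : Γ(X, W), X.evaluation W w hw r ^ q ^ N ∈
        (f.residueFieldMap w).hom.fieldRange := by
      intro r
      obtain ⟨s, a, hs, ha⟩ := hr r
      rw [hW.mem_primeIdealOf_iff hw] at hs ha
      change X.evaluation W w hw (f.appLE V W hWV s) ≠ 0 at hs
      change X.evaluation W w hw (f.appLE V W hWV s * _ - f.appLE V W hWV a) = 0 at ha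
      rw [map_sub, map_mul, map_pow, sub_eq_zero, mul_comm, ← eq_div_iff hs] at ha
      rw [ha, evaluation_appLE f hWV hw (hWV hw), evaluation_appLE f hWV hw (hWV hw)]
      exact div_mem ⟨_, rfl⟩ ⟨_, rfl⟩
    intro z
    obtain ⟨r, s, -, rfl⟩ := hW.exists_eq_evaluation_div hw z
    rw [div_pow]
    exact div_mem (key r) (key s)

/-- A closed irreducible subset of dimension at least two with generic point `η` contains a chain
of proper specializations of length two starting at `η`. -/
theorem exists_specializes_specializes_of_two_le_topologicalKrullDim {S : Type*}
    [TopologicalSpace S] [QuasiSober S] {η : S} {Z : Set S} (hη : IsGenericPoint η Z)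
    (hZ : 2 ≤ topologicalKrullDim Z) :
    ∃ s₁ s₀ : S, η ⤳ s₁ ∧ η ≠ s₁ ∧ s₁ ⤳ s₀ ∧ s₁ ≠ s₀ := by
  have hZc : IsClosed Z := hη.def ▸ isClosed_closure
  obtain ⟨l, hl⟩ := Order.le_krullDim_iff (n := 2).1 hZ
  -- an irreducible closed subset of `Z` is the closure of a point of `S`
  have hgen : ∀ T : TopologicalSpace.IrreducibleCloseds Z,
      ∃ s : S, closure {s} = (Subtype.val '' (T : Set Z)) := fun T ↦
    QuasiSober.sober (T.isIrreducible.image _ continuous_subtype_val.continuousOn)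
      (hZc.isClosedEmbedding_subtypeVal.isClosedMap _ T.isClosed)
  have h01 : l ⟨0, by omega⟩ < l ⟨1, by omega⟩ := l.strictMono (by simp [Fin.lt_def])
  have h12 : l ⟨1, by omega⟩ < l ⟨2, by omega⟩ := l.strictMono (by simp [Fin.lt_def])
  obtain ⟨s₀, hs₀⟩ := hgen (l ⟨0, by omega⟩)
  obtain ⟨s₁, hs₁⟩ := hgen (l ⟨1, by omega⟩)
  refine ⟨s₁, s₀, ?_, ?_, ?_, ?_⟩
  · rw [specializes_iff_mem_closure, hη.def]
    have : s₁ ∈ closure {s₁} := subset_closure rfl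
    rw [hs₁] at this
    exact Subtype.coe_image_subset _ _ this
  · rintro rfl
    rw [hη.def] at hs₁
    refine h12.not_ge fun z _ ↦ ?_
    obtain ⟨w, hw, hwz⟩ := hs₁.le z.2
    exact Subtype.ext hwz ▸ hw
  · rw [specializes_iff_closure_subset, hs₀, hs₁]
    exact Set.image_mono h01.le
  · rintro rfl
    refine h01.ne (SetLike.coe_injective (Subtype.val_injective.image_injective ?_))
    exact hs₀.symm.trans hs₁

/-! ### Poonen schemes -/

theorem mainTheorem3 (S : Scheme.{u}) [IsLocallyNoetherian S]
    (hS : ∀ Z ∈ irreducibleComponents S, 2 ≤ topologicalKrullDim Z) :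
    IsPoonenScheme S := by
  intro U ⟨u, hu⟩ X f _ _ _ _
  have hZ := irreducibleComponent_mem_irreducibleComponents u
  obtain ⟨η, hη⟩ := QuasiSober.sober hZ.1 (isClosed_of_mem_irreducibleComponents _ hZ)
  have hηU : η ∈ U :=
    (hη.specializes (mem_irreducibleComponent (x := u))).mem_open U.isOpen hu
  -- the generic point `η` of an irreducible component of `S` has no proper generization
  have hmax : ∀ y : S, y ⤳ η → y = η := by
    intro y hy
    have h1 : closure {η} ⊆ closure {y} := hy.closure_subset
    rw [hη.def] at h1
    exact IsGenericPoint.eq (h1.antisymm (hZ.2 isIrreducible_singleton.closure h1)).symm hη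
  obtain ⟨x, hx⟩ := mem_range_of_isDominant f (η := (⟨η, hηU⟩ : U)) fun y hy ↦
    Subtype.ext (hmax y.1 (hy.map U.ι.continuous))
  have hxη : (f ≫ U.ι) x = η := by
    rw [Scheme.Hom.comp_apply, hx]; rfl
  obtain ⟨s₁, s₀, h₁, h₁', h₀, h₀'⟩ :=
    exists_specializes_specializes_of_two_le_topologicalKrullDim hη (hS _ hZ)
  -- the specializations `s₁` and `s₀` of `η` need not lie in `U`, so `X` is viewed over `S`
  obtain ⟨w, hw⟩ := nonempty_qRelSource_of_specializes (f ≫ U.ι) (x := x) (s₁ := s₁) (s₀ := s₀)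
    (by rwa [hxη]) (by rwa [hxη]) h₀ h₀'
  refine ⟨f w, w, ?_, rfl⟩
  have hw' : IsRadicialFieldHom ((f ≫ U.ι).residueFieldMap w).hom := hw
  rw [Scheme.residueFieldMap_comp] at hw'
  exact IsRadicialFieldHom.of_comp (φ := (U.ι.residueFieldMap (f w)).hom) hw'
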